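/- Let $\Delta$ be a finite flag complex, that is, a finite simplicial complex that contains a simplex on the vertex set of every complete subgraph of its 1-skeleton. Let $G_\Delta$ be the right-angled Artin group with generators the vertices of $\Delta$ and relators the commutators $[v,w]$ for all pairs $v,w$ of adjacent vertices, and, for $\Delta$ non-empty, let $H_\Delta$ be the kernel of the homomorphism $G_\Delta\to\mathbb{Z}$ that sends every generator to $1$. If (the geometric realization of) $\Delta$ is connected and simply connected (in particular non-empty), then $H_\Delta$ is finitely presented. -/

import Mathlib

namespace AbstractSimplicialComplex

variable {V : Type*}

/-- The 1-skeleton of a simplicial complex with vertex set `V`, as a graph on `V`: two distinct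
vertices are adjacent when they span an edge. -/
def oneSkeleton [DecidableEq V] (Δ : AbstractSimplicialComplex V) : SimpleGraph V where
  Adj v w := v ≠ w ∧ ({v, w} : Finset V) ∈ Δ.faces
  symm := ⟨fun v w h => ⟨h.1.symm, by rw [Finset.pair_comm]; exact h.2⟩⟩
  loopless := ⟨fun _ h => h.1 rfl⟩

/-- A simplicial complex is flag if the vertex set of every complete subgraph of its 1-skeleton
spans a simplex. -/
def IsFlag [DecidableEq V] (Δ : AbstractSimplicialComplex V) : Prop :=
  ∀ s : Finset V, s.Nonempty → Δ.oneSkeleton.IsClique (s : Set V) → s ∈ Δ.faces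

/-- The geometric realization of a finite simplicial complex with vertex set `V`: the points of
the standard simplex in `V → ℝ` (barycentric coordinates) that are supported on a face. It carries
the subspace topology. -/
def realization [Fintype V] (Δ : AbstractSimplicialComplex V) : Set (V → ℝ) :=
  {x | x ∈ stdSimplex ℝ V ∧ ∃ s ∈ Δ.faces, ∀ v, x v ≠ 0 → v ∈ s}

/-- The relators of the right-angled Artin group: the commutators `[v, w]` for each pair of
adjacent vertices. -/
def artinRelators [DecidableEq V] (Δ : AbstractSimplicialComplex V) : Set (FreeGroup V) :=
  {r | ∃ v w, Δ.oneSkeleton.Adj v w ∧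
    r = FreeGroup.of v * FreeGroup.of w * (FreeGroup.of v)⁻¹ * (FreeGroup.of w)⁻¹}

/-- The right-angled Artin group `G_Δ`. -/
abbrev ArtinGroup [DecidableEq V] (Δ : AbstractSimplicialComplex V) : Type _ :=
  PresentedGroup Δ.artinRelators

/-- The homomorphism from `G_Δ` to the (multiplicatively written) integers that sends every
generator to `1 : ℤ`. -/
def height [DecidableEq V] (Δ : AbstractSimplicialComplex V) :
    Δ.ArtinGroup →* Multiplicative ℤ :=
  PresentedGroup.toGroup (f := fun _ : V => Multiplicative.ofAdd (1 : ℤ)) (by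
    rintro r ⟨v, w, -, rfl⟩
    simp)

/-- The group `H_Δ`, the kernel of `G_Δ → ℤ`. -/
def bestvinaBradyGroup [DecidableEq V] (Δ : AbstractSimplicialComplex V) :
    Subgroup Δ.ArtinGroup :=
  Δ.height.ker

end AbstractSimplicialComplex

/-!
Fix a base vertex `t`. Let `K` be the group with generators `p_v`, one for each vertex `v`, and
relators `p_t` and `[p_u⁻¹ p_v, p_v⁻¹ p_w]` for every triangle `u, v, w`. It is finitely presented,
and `p_v ↦ t v⁻¹` maps it to the Bestvina–Brady group `H`, the element `p_v⁻¹ p_w` of an edge going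
to `v w⁻¹`. This map is an isomorphism (`bestvinaBradyGroup_equiv`), for the following reason.

Conjugation by `t` sends `v w⁻¹` to `t w⁻¹ · (t v⁻¹)⁻¹`, so one needs an automorphism `φ` of `K`
that sends `p_v⁻¹ p_w` to `p_w p_v⁻¹` for every edge. It is the composite of two involutions: one
inverts every generator `p_v`, the other inverts every edge element `p_v⁻¹ p_w`. The first visibly
respects the relators. The second exists if and only if there are `q_v` in `K` with
`q_v⁻¹ q_w = (p_v⁻¹ p_w)⁻¹` for all edges. On a triangle the edge elements commute, so their
inverses form a cocycle, and simple connectivity makes it a coboundary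
(`exists_vertex_labelling`). With `φ` at hand, `v ↦ p_v⁻¹ t` defines a homomorphism from the Artin
group to `K ⋊ ℤ` with inverse `p_v ↦ t v⁻¹`, `1 ↦ t`, and it carries the height to the projection
onto `ℤ`; so `K` corresponds to `H`.

That cocycles are coboundaries is proved directly on the realization
(`exists_eq_inv_mul_of_cocycle`): the open stars of the vertices are connected, two of them meet
exactly when the vertices are equal or adjacent, and a cocycle with values in a discrete group is
the transition data of a covering. Over a simply connected, locally path connected space this
covering has a section, and the section is constant in the chart over each star.
-/

open Set
open scoped Topology commutatorElement

/-! ### Cocycles on open covers -/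

/-- The principal bundle with discrete fibre `Γ` whose transition function from `U i` to `U j` is
right multiplication by the constant `c i j`. -/
def cocycleBundleCore {X ι Γ : Type*} [TopologicalSpace X] [Group Γ] [TopologicalSpace Γ]
    [DiscreteTopology Γ] (U : ι → Set X) (hU : ∀ i, IsOpen (U i)) (ind : X → ι)
    (hind : ∀ x, x ∈ U (ind x)) (c : ι → ι → Γ)
    (hc : ∀ i j k, (U i ∩ U j ∩ U k).Nonempty → c i j * c j k = c i k) :
    FiberBundleCore ι X Γ where
  baseSet := U
  isOpen_baseSet := hU
  indexAt := ind
  mem_baseSet_at := hind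
  coordChange i j _ a := a * c i j
  coordChange_self i x hx a := by
    have := hc i i i ⟨x, ⟨hx, hx⟩, hx⟩
    simpa using this
  continuousOn_coordChange i j :=
    ((continuous_of_discreteTopology (f := fun a : Γ => a * c i j)).comp
      continuous_snd).continuousOn
  coordChange_comp i j k x hx a := by
    rw [mul_assoc, hc i j k ⟨x, hx⟩]

/-- On a simply connected space, a locally constant cocycle for a cover by connected open sets is a
coboundary: the bundle it defines is a covering, hence has a global section, and in the chart over
`U i` this section is a constant `g i`. -/
theorem exists_eq_inv_mul_of_cocycle {X ι Γ : Type*} [TopologicalSpace X]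
    [SimplyConnectedSpace X] [LocallyPathConnectedSpace X] [Group Γ] (U : ι → Set X)
    (hU : ∀ i, IsOpen (U i)) (hcover : ∀ x, ∃ i, x ∈ U i) (hconn : ∀ i, IsPreconnected (U i))
    (c : ι → ι → Γ)
    (hc : ∀ i j k, (U i ∩ U j ∩ U k).Nonempty → c i j * c j k = c i k) :
    ∃ g : ι → Γ, ∀ i j, (U i ∩ U j).Nonempty → (g i)⁻¹ * g j = c i j := by
  let _ : TopologicalSpace Γ := ⊥
  have : DiscreteTopology Γ := ⟨rfl⟩
  choose ind hind using hcover
  let Z := cocycleBundleCore U hU ind hind c hc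
  have hcov : IsCoveringMap Z.proj :=
    IsFiberBundle.isCoveringMap fun x => ⟨Z.localTriv (ind x), hind x⟩
  obtain ⟨x₀⟩ : Nonempty X := inferInstance
  obtain ⟨s, ⟨-, hs⟩, -⟩ :=
    hcov.existsUnique_continuousMap_lifts (ContinuousMap.id X) x₀ ⟨x₀, (1 : Γ)⟩ rfl
  have hs' : ∀ x, (s x).proj = x := fun x => congrFun hs x
  -- the section read in the chart over `U i`
  let σ : ι → X → Γ := fun i x => (Z.localTriv i (s x)).2
  have hσ : ∀ i, ContinuousOn (σ i) (U i) := fun i =>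
    continuous_snd.comp_continuousOn ((Z.localTriv i).continuousOn.comp s.continuous.continuousOn
      fun x hx => by
        rw [Z.mem_localTriv_source, hs']
        exact hx)
  have hchange : ∀ i j x, x ∈ U i → x ∈ U j → σ j x = σ i x * c i j := by
    intro i j x hi hj
    have hx := hs' x
    let a : Γ := (s x).2
    change a * c (ind (s x).proj) j = a * c (ind (s x).proj) i * c i j
    rw [mul_assoc, hx, hc _ _ _ ⟨x, ⟨hind x, hi⟩, hj⟩]
  have hconst : ∀ i, ∃ a, ∀ x ∈ U i, σ i x = a := by
    intro i
    rcases (U i).eq_empty_or_nonempty with h | ⟨y, hy⟩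
    · exact ⟨1, by simp [h]⟩
    · exact ⟨σ i y, fun x hx => (hconn i).constant (hσ i) hx hy⟩
  choose g hg using hconst
  refine ⟨g, fun i j ⟨x, hi, hj⟩ => ?_⟩
  rw [← hg i x hi, ← hg j x hj, hchange i j x hi hj, inv_mul_cancel_left]

/-- On a preconnected space, a function on the index set of a cover by nonempty open sets is
constant if it agrees on indices of overlapping members. -/
theorem eq_of_forall_inter_nonempty {X ι α : Type*} [TopologicalSpace X] [PreconnectedSpace X]
    (U : ι → Set X) (hU : ∀ i, IsOpen (U i)) (hne : ∀ i, (U i).Nonempty)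
    (hcover : ∀ x, ∃ i, x ∈ U i) (f : ι → α)
    (hf : ∀ i j, (U i ∩ U j).Nonempty → f i = f j) (i j : ι) : f i = f j := by
  choose ind hind using hcover
  have key : ∀ i, ∀ x ∈ U i, f (ind x) = f i := fun i x hx => hf _ _ ⟨x, hind x, hx⟩
  have hlc : IsLocallyConstant fun x => f (ind x) :=
    IsLocallyConstant.iff_exists_open _ |>.2 fun x =>
      ⟨U (ind x), hU _, hind x, fun y hy => key _ y hy⟩
  obtain ⟨x, hx⟩ := hne i
  obtain ⟨y, hy⟩ := hne j
  rw [← key i x hx, ← key j y hy]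
  exact hlc.apply_eq_of_preconnectedSpace x y

namespace AbstractSimplicialComplex

/-! ### Open stars in the realization -/

section Realization

variable {V : Type*} [Fintype V] (Δ : AbstractSimplicialComplex V)

/-- The open star of the vertex `v`: the points whose barycentric coordinate at `v` is positive. -/
def openStar (v : V) : Set Δ.realization := {x | 0 < x.1 v}

theorem isOpen_openStar (v : V) : IsOpen (Δ.openStar v) :=
  isOpen_lt continuous_const ((continuous_apply v).comp continuous_subtype_val)

theorem exists_mem_openStar (x : Δ.realization) : ∃ v, x ∈ Δ.openStar v := by
  by_contra! h
  have h0 : ∀ v, x.1 v = 0 := fun v => le_antisymm (not_lt.1 (h v)) (x.2.1.1 v)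
  have h1 := x.2.1.2
  simp [h0] at h1

variable {Δ}

theorem segment_subset_realization {x y : V → ℝ} (hx : x ∈ Δ.realization)
    (hy : y ∈ Δ.realization) (hxy : ∀ v, x v ≠ 0 → y v ≠ 0) :
    segment ℝ x y ⊆ Δ.realization := by
  intro z hz
  obtain ⟨s, hs, hys⟩ := hy.2
  refine ⟨(convex_stdSimplex ℝ V).segment_subset hx.1 hy.1 hz, s, hs, fun v hv => ?_⟩
  obtain ⟨a, b, -, -, -, rfl⟩ := hz
  by_contra hvs
  have hyv : y v = 0 := by_contra fun h => hvs (hys v h)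
  have hxv : x v = 0 := by_contra fun h => hxy v h hyv
  simp [hxv, hyv] at hv

variable (Δ)

/-- A point near `x` has positive coordinates wherever `x` does, so it lies in a common face with
`x`; hence small balls are star-shaped. -/
instance : LocallyPathConnectedSpace Δ.realization := by
  have hδ : ∀ x : Δ.realization, ∃ δ > 0, ∀ v, x.1 v ≠ 0 → δ ≤ x.1 v := by
    intro x
    have h := (Filter.eventually_all (l := 𝓝[>] (0 : ℝ))
      (p := fun (v : V) (δ : ℝ) => x.1 v ≠ 0 → δ ≤ x.1 v)).2 fun v => by
        by_cases hv : x.1 v = 0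
        · simp [hv]
        · have : 0 < x.1 v := lt_of_le_of_ne (x.2.1.1 v) (Ne.symm hv)
          filter_upwards [nhdsWithin_le_nhds (Iic_mem_nhds this)] with δ hδ _ using hδ
    obtain ⟨δ, h1, h2⟩ := (h.and self_mem_nhdsWithin).exists
    exact ⟨δ, h2, h1⟩
  choose δ hδ0 hδ using hδ
  refine LocallyPathConnectedSpace.of_bases (p := fun x ε => 0 < ε ∧ ε ≤ δ x)
    (s := fun x ε => Metric.ball x ε) (fun x => ?_) fun x ε hε => ?_
  · exact Metric.nhds_basis_ball.restrict fun ε hε =>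
      ⟨min ε (δ x), lt_min hε (hδ0 x), min_le_right _ _,
        Metric.ball_subset_ball (min_le_left _ _)⟩
  · rw [Topology.IsInducing.subtypeVal.isPathConnected_iff]
    refine StarConvex.isPathConnected (a := x.1) (starConvex_iff_segment_subset.2 ?_)
      ⟨x, Metric.mem_ball_self hε.1, rfl⟩
    rintro _ ⟨y, hy, rfl⟩ z hz
    have hxy : ∀ v, x.1 v ≠ 0 → y.1 v ≠ 0 := fun v hv h0 => by
      have h1 : dist (y.1 v) (x.1 v) < ε := (dist_le_pi_dist y.1 x.1 v).trans_lt hy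
      rw [h0, dist_zero_left, Real.norm_eq_abs] at h1
      linarith [hδ x v hv, hε.2, le_abs_self (x.1 v)]
    refine ⟨⟨z, segment_subset_realization x.2 y.2 hxy hz⟩, ?_, rfl⟩
    exact (convex_ball x.1 ε).segment_subset (Metric.mem_ball_self hε.1) hy hz

variable [DecidableEq V]

theorem single_mem_realization (v : V) : Pi.single v (1 : ℝ) ∈ Δ.realization :=
  ⟨single_mem_stdSimplex ℝ v, {v}, Δ.singleton_mem v, fun w hw => by
    by_contra h
    exact hw (Pi.single_eq_of_ne (by simpa using h) _)⟩

theorem openStar_nonempty (v : V) : (Δ.openStar v).Nonempty :=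
  ⟨⟨_, Δ.single_mem_realization v⟩, by simp [openStar]⟩

theorem isPreconnected_openStar (v : V) : IsPreconnected (Δ.openStar v) := by
  refine IsPathConnected.isConnected ?_ |>.isPreconnected
  rw [Topology.IsInducing.subtypeVal.isPathConnected_iff]
  refine StarConvex.isPathConnected (a := Pi.single v (1 : ℝ))
    (starConvex_iff_segment_subset.2 ?_) 
    ⟨⟨_, Δ.single_mem_realization v⟩, by simp [openStar], rfl⟩
  rintro _ ⟨y, hy, rfl⟩ z hz
  have hy : 0 < y.1 v := hy
  refine ⟨⟨z, segment_subset_realization (Δ.single_mem_realization v) y.2 (fun w hw => ?_) hz⟩,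
    ?_, rfl⟩
  · obtain rfl : w = v := by_contra fun h => hw (Pi.single_eq_of_ne h _)
    exact hy.ne'
  · exact (convex_halfSpace_gt (f := fun x : V → ℝ => x v) ⟨by simp, by simp⟩ 0).segment_subset
      (by simp) hy hz

variable {Δ}

theorem adj_of_mem_openStar {x : Δ.realization} {v w : V} (hv : x ∈ Δ.openStar v)
    (hw : x ∈ Δ.openStar w) (hvw : v ≠ w) : Δ.oneSkeleton.Adj v w := by
  obtain ⟨s, hs, hxs⟩ := x.2.2
  refine ⟨hvw, (Δ.isRelLowerSet_faces hs).2 ?_ (by simp)⟩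
  have hv : 0 < x.1 v := hv
  have hw : 0 < x.1 w := hw
  intro u hu
  rcases Finset.mem_insert.1 hu with rfl | hu
  · exact hxs _ hv.ne'
  · rw [Finset.mem_singleton.1 hu]
    exact hxs _ hw.ne'

/-- Adjacent vertices have overlapping open stars: both contain the midpoint of the edge. -/
theorem openStar_inter_nonempty {v w : V} (h : Δ.oneSkeleton.Adj v w) :
    (Δ.openStar v ∩ Δ.openStar w).Nonempty := by
  have hmem : (1 / 2 : ℝ) • Pi.single v (1 : ℝ) + (1 / 2 : ℝ) • Pi.single w (1 : ℝ) ∈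
      Δ.realization := by
    refine ⟨convex_stdSimplex ℝ V (single_mem_stdSimplex ℝ v) (single_mem_stdSimplex ℝ w)
      (by norm_num) (by norm_num) (by norm_num), {v, w}, h.2, fun u hu => ?_⟩
    by_contra h'
    simp only [Finset.mem_insert, Finset.mem_singleton, not_or] at h'
    simp [h'.1, h'.2] at hu
  refine ⟨⟨_, hmem⟩, ?_, ?_⟩
  · simp [openStar, h.1]
  · simp [openStar, h.1.symm]

theorem oneSkeleton_preconnected [PreconnectedSpace Δ.realization] :
    Δ.oneSkeleton.Preconnected := by
  intro v w
  refine SimpleGraph.ConnectedComponent.exact (eq_of_forall_inter_nonempty Δ.openStar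
    Δ.isOpen_openStar Δ.openStar_nonempty Δ.exists_mem_openStar
    Δ.oneSkeleton.connectedComponentMk ?_ v w)
  rintro i j ⟨x, hi, hj⟩
  by_cases hij : i = j
  · rw [hij]
  · exact SimpleGraph.ConnectedComponent.sound (adj_of_mem_openStar hi hj hij).reachable

/-- If the realization is simply connected, an edge labelling that is compatible with triangles is
the coboundary of a vertex labelling. -/
theorem exists_vertex_labelling [SimplyConnectedSpace Δ.realization] {Γ : Type*} [Group Γ]
    (c : V → V → Γ) (h1 : ∀ v, c v v = 1)
    (h2 : ∀ v w, Δ.oneSkeleton.Adj v w → c v w * c w v = 1)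
    (h3 : ∀ u v w, Δ.oneSkeleton.Adj u v → Δ.oneSkeleton.Adj v w → Δ.oneSkeleton.Adj u w →
      c u v * c v w = c u w) :
    ∃ g : V → Γ, ∀ v w, Δ.oneSkeleton.Adj v w → (g v)⁻¹ * g w = c v w := by
  have hc : ∀ u v w, (Δ.openStar u ∩ Δ.openStar v ∩ Δ.openStar w).Nonempty →
      c u v * c v w = c u w := by
    rintro u v w ⟨x, ⟨hu, hv⟩, hw⟩
    by_cases huv : u = v
    · rw [huv, h1, one_mul]
    by_cases hvw : v = w
    · rw [hvw, h1, mul_one]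
    have huv' := adj_of_mem_openStar hu hv huv
    by_cases huw : u = w
    · rw [← huw, h1, h2 u v huv']
    · exact h3 u v w huv' (adj_of_mem_openStar hv hw hvw) (adj_of_mem_openStar hu hw huw)
  obtain ⟨g, hg⟩ := exists_eq_inv_mul_of_cocycle Δ.openStar Δ.isOpen_openStar
    Δ.exists_mem_openStar Δ.isPreconnected_openStar c hc
  exact ⟨g, fun v w h => hg v w (openStar_inter_nonempty h)⟩

end Realization

/-! ### A presentation with one generator per vertex -/

section Presentation

variable {V : Type*} [DecidableEq V] (Δ : AbstractSimplicialComplex V) (t : V)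

/-- The relators of `Δ.VertexGroup t`: the base vertex `t`, and for every triangle `u, v, w` the
commutator of the edge elements `u⁻¹ v` and `v⁻¹ w`. -/
def vertexRelators : Set (FreeGroup V) :=
  {FreeGroup.of t} ∪ {r | ∃ u v w, Δ.oneSkeleton.Adj u v ∧ Δ.oneSkeleton.Adj v w ∧
    Δ.oneSkeleton.Adj u w ∧
    r = ⁅(FreeGroup.of u)⁻¹ * FreeGroup.of v, (FreeGroup.of v)⁻¹ * FreeGroup.of w⁆}

/-- The group with one generator for each vertex `v`, to be thought of as the element `t v⁻¹` of
the Bestvina–Brady group; the edge `v, w` then gives the element `v w⁻¹`. -/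
abbrev VertexGroup : Type _ := PresentedGroup (Δ.vertexRelators t)

theorem finite_vertexRelators [Finite V] : (Δ.vertexRelators t).Finite := by
  refine (finite_singleton _).union ((finite_range fun p : V × V × V =>
    ⁅(FreeGroup.of p.1)⁻¹ * FreeGroup.of p.2.1,
      (FreeGroup.of p.2.1)⁻¹ * FreeGroup.of p.2.2⁆).subset ?_)
  rintro r ⟨u, v, w, -, -, -, rfl⟩
  exact ⟨(u, v, w), rfl⟩

namespace VertexGroup

variable {Δ t}

/-- The generator of `Δ.VertexGroup t` attached to a vertex. -/
def of (v : V) : Δ.VertexGroup t := PresentedGroup.of v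

theorem of_base : (of t : Δ.VertexGroup t) = 1 :=
  PresentedGroup.one_of_mem (Or.inl rfl)

theorem commute_of {u v w : V} (huv : Δ.oneSkeleton.Adj u v) (hvw : Δ.oneSkeleton.Adj v w)
    (huw : Δ.oneSkeleton.Adj u w) :
    Commute ((of u : Δ.VertexGroup t)⁻¹ * of v) ((of v)⁻¹ * of w) :=
  commutatorElement_eq_one_iff_commute.1
    (PresentedGroup.one_of_mem (rels := Δ.vertexRelators t) (Or.inr ⟨u, v, w, huv, hvw, huw, rfl⟩))

/-- The homomorphism out of `Δ.VertexGroup t` with prescribed values on the generators. -/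
def lift {Γ : Type*} [Group Γ] (f : V → Γ) (ht : f t = 1)
    (hf : ∀ u v w, Δ.oneSkeleton.Adj u v → Δ.oneSkeleton.Adj v w → Δ.oneSkeleton.Adj u w →
      Commute ((f u)⁻¹ * f v) ((f v)⁻¹ * f w)) : Δ.VertexGroup t →* Γ :=
  PresentedGroup.toGroup (f := f) (by
    rintro r (rfl | ⟨u, v, w, huv, hvw, huw, rfl⟩)
    · simpa using ht
    · rw [map_commutatorElement, commutatorElement_eq_one_iff_commute]
      simpa using hf u v w huv hvw huw)

@[simp]
theorem lift_of {Γ : Type*} [Group Γ] (f : V → Γ) (ht : f t = 1)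
    (hf : ∀ u v w, Δ.oneSkeleton.Adj u v → Δ.oneSkeleton.Adj v w → Δ.oneSkeleton.Adj u w →
      Commute ((f u)⁻¹ * f v) ((f v)⁻¹ * f w)) (v : V) : lift f ht hf (of v) = f v :=
  PresentedGroup.toGroup.of _

/-- Homomorphisms out of `Δ.VertexGroup t` that agree on edge elements are equal, since every
vertex is joined to `t`, whose generator is trivial. -/
theorem hom_ext_of_edges (hconn : Δ.oneSkeleton.Preconnected) {Γ : Type*} [Group Γ]
    {f g : Δ.VertexGroup t →* Γ}
    (h : ∀ v w, Δ.oneSkeleton.Adj v w → f ((of v)⁻¹ * of w) = g ((of v)⁻¹ * of w)) : f = g := by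
  refine PresentedGroup.ext fun v => ?_
  change f (of v) = g (of v)
  have hwalk : ∀ {a b : V}, Δ.oneSkeleton.Walk a b → f (of b) = g (of b) → f (of a) = g (of a) := by
    intro a b p hb
    induction p with
    | nil => exact hb
    | cons hadj _ ih =>
      have h1 := h _ _ hadj
      rw [map_mul, map_mul, map_inv, map_inv, ih hb] at h1
      exact inv_injective (mul_right_cancel h1)
  obtain ⟨p⟩ := hconn v t
  exact hwalk p (by rw [of_base, map_one, map_one])

variable (Δ t) in
theorem exists_inv_generators :
    ∃ θ : MulAut (Δ.VertexGroup t), ∀ v, θ (of v) = (of v)⁻¹ := by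
  let f : Δ.VertexGroup t →* Δ.VertexGroup t :=
    lift (fun v => (of v)⁻¹) (by rw [of_base, inv_one]) fun u v w huv hvw huw => by
      -- conjugating by the generator `v` turns these into inverses of the edge elements
      have h := (commute_of (t := t) huv hvw huw).inv_inv.map (MulAut.conj (of v))
      simpa [mul_assoc] using h
  have hf : ∀ v, f (of v) = (of v)⁻¹ := fun v => lift_of _ _ _ v
  have hff : f.comp f = MonoidHom.id _ := PresentedGroup.ext fun v => by
    change f (f (of v)) = of v
    rw [hf, map_inv, hf, inv_inv]
  exact ⟨f.toMulEquiv f hff hff, hf⟩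

/-- If the vertices can be labelled so that every edge element is inverted, then inverting all edge
elements is an automorphism. -/
theorem exists_inv_edges (hconn : Δ.oneSkeleton.Preconnected)
    (hq : ∃ q : V → Δ.VertexGroup t, ∀ v w, Δ.oneSkeleton.Adj v w →
      (q v)⁻¹ * q w = (of w)⁻¹ * of v) :
    ∃ φ : MulAut (Δ.VertexGroup t), ∀ v w, Δ.oneSkeleton.Adj v w →
      φ ((of v)⁻¹ * of w) = (of w)⁻¹ * of v := by
  obtain ⟨q, hq⟩ := hq
  have hq' : ∀ v w, Δ.oneSkeleton.Adj v w →
      ((q t)⁻¹ * q v)⁻¹ * ((q t)⁻¹ * q w) = (of w)⁻¹ * of v := fun v w h => by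
    rw [← hq v w h]
    group
  let f : Δ.VertexGroup t →* Δ.VertexGroup t :=
    lift (fun v => (q t)⁻¹ * q v) (inv_mul_cancel _) fun u v w huv hvw huw => by
      rw [hq' u v huv, hq' v w hvw]
      simpa using (commute_of (t := t) huv hvw huw).inv_inv
  have hf : ∀ v w, Δ.oneSkeleton.Adj v w → f ((of v)⁻¹ * of w) = (of w)⁻¹ * of v :=
    fun v w h => by
      rw [← hq' v w h]
      simp only [f, map_mul, map_inv, lift_of]
  have hff : f.comp f = MonoidHom.id _ := hom_ext_of_edges hconn fun v w h => by
    rw [MonoidHom.comp_apply, hf v w h, hf w v h.symm, MonoidHom.id_apply]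
  exact ⟨f.toMulEquiv f hff hff, hf⟩

/-- The automorphism that corresponds to conjugation by `t` in the Artin group: it sends
`v w⁻¹ = p_v⁻¹ p_w` to `t v w⁻¹ t⁻¹ = p_w p_v⁻¹`, where `p_v` is the generator of `v`. -/
theorem exists_conj_base (hconn : Δ.oneSkeleton.Preconnected)
    (hq : ∃ q : V → Δ.VertexGroup t, ∀ v w, Δ.oneSkeleton.Adj v w →
      (q v)⁻¹ * q w = (of w)⁻¹ * of v) :
    ∃ φ : MulAut (Δ.VertexGroup t), ∀ v w, Δ.oneSkeleton.Adj v w →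
      φ ((of v)⁻¹ * of w) = of w * (of v)⁻¹ := by
  obtain ⟨φ, hφ⟩ := exists_inv_edges hconn hq
  obtain ⟨θ, hθ⟩ := exists_inv_generators Δ t
  refine ⟨φ.trans θ, fun v w h => ?_⟩
  rw [MulEquiv.trans_apply, hφ v w h, map_mul, map_inv, hθ, hθ, inv_inv]

end VertexGroup

end Presentation

/-! ### Comparison with the Bestvina–Brady group -/

section Comparison

variable {V : Type*} [DecidableEq V] {Δ : AbstractSimplicialComplex V} {t : V}

open VertexGroup

/-- The generator of the Artin group attached to a vertex. -/
def artinGen (v : V) : Δ.ArtinGroup := PresentedGroup.of v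

theorem artinGen_commute {v w : V} (h : Δ.oneSkeleton.Adj v w) :
    Commute (artinGen v : Δ.ArtinGroup) (artinGen w) := by
  rw [← commutatorElement_eq_one_iff_commute]
  exact PresentedGroup.one_of_mem (rels := Δ.artinRelators) ⟨v, w, h, rfl⟩

@[simp]
theorem height_artinGen (v : V) : Δ.height (artinGen v) = Multiplicative.ofAdd 1 :=
  PresentedGroup.toGroup.of _

variable (Δ t)

/-- The homomorphism to the Artin group that sends the generator of `v` to `t v⁻¹`. -/
def VertexGroup.toArtin : Δ.VertexGroup t →* Δ.ArtinGroup :=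
  VertexGroup.lift (fun v => artinGen t * (artinGen v)⁻¹) (mul_inv_cancel _)
    fun u v w huv hvw huw => by
      have h1 := artinGen_commute huv
      have h2 := artinGen_commute hvw
      have h3 := artinGen_commute huw
      have key : Commute (artinGen u * (artinGen v)⁻¹ : Δ.ArtinGroup)
          (artinGen v * (artinGen w)⁻¹) :=
        (h1.mul_right h3.inv_right).mul_left
          ((Commute.refl _).inv_left.mul_right h2.inv_inv)
      simpa [mul_assoc] using key

variable {Δ t}

@[simp]
theorem VertexGroup.toArtin_of (v : V) :
    toArtin Δ t (of v) = artinGen t * (artinGen v)⁻¹ :=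
  lift_of _ _ _ v

theorem VertexGroup.height_toArtin (k : Δ.VertexGroup t) : Δ.height (toArtin Δ t k) = 1 := by
  have h : Δ.height.comp (toArtin Δ t) = 1 := PresentedGroup.ext fun v => by
    change Δ.height (toArtin Δ t (of v)) = 1
    simp
  exact DFunLike.congr_fun h k

theorem map_zpow_apply_of_forall {K G : Type*} [Group K] [Group G] (f : K →* G) (φ : MulAut K)
    (ψ : MulAut G) (h : ∀ k, f (φ k) = ψ (f k)) (n : ℤ) (k : K) :
    f ((φ ^ n) k) = (ψ ^ n) (f k) := by
  induction n generalizing k with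
  | zero => simp
  | succ n ih => rw [zpow_add_one, zpow_add_one, MulAut.mul_apply, MulAut.mul_apply, ih, h]
  | pred n ih =>
    have h' : f (φ⁻¹ k) = ψ⁻¹ (f k) := by
      apply ψ.injective
      rw [← h, MulAut.apply_inv_self, MulAut.apply_inv_self]
    rw [zpow_sub_one, zpow_sub_one, MulAut.mul_apply, MulAut.mul_apply, ih, h']

/-- The Artin group is the semidirect product of `Δ.VertexGroup t` with `ℤ`, where the generator of
`ℤ` corresponds to `t`; so `Δ.VertexGroup t` is the kernel of the height homomorphism. -/
theorem bestvinaBradyGroup_equiv (hconn : Δ.oneSkeleton.Preconnected)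
    (hq : ∃ q : V → Δ.VertexGroup t, ∀ v w, Δ.oneSkeleton.Adj v w →
      (q v)⁻¹ * q w = (of w)⁻¹ * of v) :
    Nonempty (Δ.VertexGroup t ≃* Δ.bestvinaBradyGroup) := by
  obtain ⟨φ, hφ⟩ := exists_conj_base hconn hq
  let S := Δ.VertexGroup t ⋊[zpowersHom (MulAut (Δ.VertexGroup t)) φ] Multiplicative ℤ
  let τ : S := SemidirectProduct.inr (Multiplicative.ofAdd 1)
  have hτ : ∀ k : Δ.VertexGroup t,
      τ * SemidirectProduct.inl k = SemidirectProduct.inl (φ k) * τ := fun k => by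
    have := SemidirectProduct.inl_aut (φ := zpowersHom (MulAut (Δ.VertexGroup t)) φ)
      (Multiplicative.ofAdd 1) k
    rw [zpowersHom_apply, toAdd_ofAdd, zpow_one] at this
    rw [this, map_inv, inv_mul_cancel_right]
  -- the images of adjacent generators commute because `p_v⁻¹ φ(p_w⁻¹) = p_w⁻¹ φ(p_v⁻¹)`
  have hcomm : ∀ v w, Δ.oneSkeleton.Adj v w →
      Commute (SemidirectProduct.inl (of v)⁻¹ * τ : S) (SemidirectProduct.inl (of w)⁻¹ * τ) := by
    intro v w h
    have h1 : (of v)⁻¹ * φ (of w)⁻¹ = (of w)⁻¹ * φ (of v : Δ.VertexGroup t)⁻¹ := by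
      have h2 := hφ w v h.symm
      have h3 : φ (of w)⁻¹ = of v * (of w)⁻¹ * φ (of v)⁻¹ := by
        rw [← h2, ← map_mul, mul_inv_cancel_right]
      rw [h3, mul_assoc, inv_mul_cancel_left]
    have hmul : ∀ a b : Δ.VertexGroup t, (SemidirectProduct.inl a * τ : S) *
        (SemidirectProduct.inl b * τ) = SemidirectProduct.inl (a * φ b) * (τ * τ) := fun a b => by
      rw [mul_assoc, ← mul_assoc τ, hτ, mul_assoc _ τ, ← mul_assoc, map_mul]
    rw [commute_iff_eq, hmul, hmul, h1]
  let F : Δ.ArtinGroup →* S :=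
    PresentedGroup.toGroup (f := fun v => SemidirectProduct.inl (of v)⁻¹ * τ) (by
      rintro r ⟨v, w, h, rfl⟩
      have := commutatorElement_eq_one_iff_commute.2 (hcomm v w h)
      simpa [commutatorElement_def] using this)
  have hF : ∀ v, F (artinGen v) = SemidirectProduct.inl (of v)⁻¹ * τ :=
    fun v => PresentedGroup.toGroup.of _
  -- `F` restricts to the inclusion of the normal factor, so `toArtin` is injective
  have hFinl : F.comp (toArtin Δ t) = SemidirectProduct.inl := PresentedGroup.ext fun v => by
    change F (toArtin Δ t (of v)) = SemidirectProduct.inl (of v)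
    rw [toArtin_of, map_mul, map_inv, hF, hF, of_base, map_inv SemidirectProduct.inl (of v)]
    simp only [inv_one, map_one, one_mul, mul_inv_rev, mul_inv_cancel_left]
    exact inv_inv _
  have hinj : Function.Injective (toArtin Δ t) := by
    have : Function.Injective (F.comp (toArtin Δ t)) := by
      rw [hFinl]
      exact SemidirectProduct.inl_injective
    exact Function.Injective.of_comp (f := F) this
  have hconj : ∀ k, toArtin Δ t (φ k) = MulAut.conj (artinGen t) (toArtin Δ t k) := by
    have : (toArtin Δ t).comp φ.toMonoidHom =
        (MulAut.conj (artinGen t)).toMonoidHom.comp (toArtin Δ t) :=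
      hom_ext_of_edges hconn fun v w h => by
        change toArtin Δ t (φ ((of v)⁻¹ * of w)) =
          MulAut.conj (artinGen t) (toArtin Δ t ((of v)⁻¹ * of w))
        rw [hφ v w h]
        have hc := (artinGen_commute h).inv_right.eq
        simp [mul_assoc, hc]
    exact DFunLike.congr_fun this
  -- the inverse of `F`
  let B : S →* Δ.ArtinGroup := SemidirectProduct.lift (toArtin Δ t)
    (zpowersHom Δ.ArtinGroup (artinGen t)) fun n => MonoidHom.ext fun k => by
      change toArtin Δ t ((φ ^ n.toAdd) k) =
        MulAut.conj (artinGen t ^ n.toAdd) (toArtin Δ t k)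
      rw [map_zpow_apply_of_forall _ _ _ hconj, map_zpow]
  have hBF : B.comp F = MonoidHom.id _ := PresentedGroup.ext fun v => by
    change B (F (artinGen v)) = artinGen v
    rw [hF, map_mul, SemidirectProduct.lift_inl, SemidirectProduct.lift_inr, map_inv, toArtin_of]
    simp
  have hheight : SemidirectProduct.rightHom.comp F = Δ.height := PresentedGroup.ext fun v => by
    change SemidirectProduct.rightHom (F (artinGen v)) = Δ.height (artinGen v)
    rw [hF, height_artinGen, map_mul, SemidirectProduct.rightHom_inl,
      SemidirectProduct.rightHom_inr, one_mul]
  have hrange : (toArtin Δ t).range = Δ.bestvinaBradyGroup := by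
    apply le_antisymm
    · rintro _ ⟨k, rfl⟩
      exact height_toArtin k
    · intro h hh
      have h1 : (F h).right = 1 := by
        have := DFunLike.congr_fun hheight h
        rw [MonoidHom.mem_ker.1 hh] at this
        exact this
      refine ⟨(F h).left, ?_⟩
      have h2 := DFunLike.congr_fun hBF h
      rw [MonoidHom.comp_apply, ← SemidirectProduct.inl_left_mul_inr_right (F h), h1, map_one,
        mul_one, SemidirectProduct.lift_inl] at h2
      exact h2
  exact ⟨(MonoidHom.ofInjective hinj).trans (MulEquiv.subgroupCongr hrange)⟩

end Comparison

end AbstractSimplicialComplex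

open AbstractSimplicialComplex VertexGroup in
theorem corollary3 {V : Type*} [Fintype V] [DecidableEq V] (Δ : AbstractSimplicialComplex V)
    (hflag : Δ.IsFlag) (hsc : SimplyConnectedSpace Δ.realization) :
    Group.IsFinitelyPresented Δ.bestvinaBradyGroup := by
  obtain ⟨x⟩ : Nonempty Δ.realization := inferInstance
  obtain ⟨t, -⟩ := Δ.exists_mem_openStar x
  -- inverting all edge labels is compatible with triangles because their edge elements commute
  have hq : ∃ q : V → Δ.VertexGroup t, ∀ v w, Δ.oneSkeleton.Adj v w →
      (q v)⁻¹ * q w = (of w)⁻¹ * of v :=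
    exists_vertex_labelling (fun v w => (of w)⁻¹ * of v) (fun v => inv_mul_cancel _)
      (fun v w _ => by group) fun u v w huv hvw huw => by
        have h := (commute_of (t := t) huv hvw huw).inv_inv.eq
        simp only [mul_inv_rev, inv_inv] at h
        rw [h]
        group
  obtain ⟨e⟩ := bestvinaBradyGroup_equiv oneSkeleton_preconnected hq
  have := (Δ.finite_vertexRelators t).to_subtype
  exact Group.IsFinitelyPresented.equiv e
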